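/- Let $G=(V,E)$ be a finite undirected network with $m=|V|\ge 1$ users, let $D\subseteq V$ be a dominating set of $G$ (every node outside $D$ is adjacent to a node of $D$), and let a dominating set partition based on $D$ be given: a partition of $V$ into $|D|$ components, each consisting of one node of $D$ and some of its neighbours. All users face the same stochastic bandit problem with arms $1,\dots,K$ ($K\ge 1$), where arm $i$ has a reward distribution on $[0,1]$ with mean $\mu_i$; the rewards $X^v_i(t)$, over all users $v$, arms $i$ and rounds $t$, are independent, $X^v_i(t)$ having the distribution of arm $i$. Put $\mu^*=\max_i\mu_i$ and $\Delta_i=\mu^*-\mu_i$. In each round every user $v$ plays one arm, $a^v(t)$, receives the reward $X^v_{a^v(t)}(t)$, and before the next round has seen the actions and rewards of itself and its neighbours. The network runs the Follow Your Leader (FYL) policy. Each leader $v\in D$ plays arm $t$ in round $t$ for $1\le t\le K$, and for $t\ge K$ plays in round $t+1$ an arm $j$ that maximizes $\hat\mu_j(t)+\sqrt{2\ln t/m_j(t)}$ (ties broken arbitrarily on the basis of what $v$ knows), where $m_j(t)$ is the number of times that arm $j$ was played in the component of $v$ in rounds $1,\dots,t$, and $\hat\mu_j(t)$ is the average of the corresponding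 rewards. Each follower $v\in V\setminus D$ plays in round $1$ a random arm (the random arms of the users may have any joint law, but are independent of the rewards), and in every round $t>1$ the arm that the leader of its component played in round $t-1$. Then, for every horizon $n$ and every $\beta\in(1/4,1)$, the expected network regret $\mathbb{E}[R^G(n)]=\mathbb{E}\big[\sum_{v\in V}\sum_{t=1}^n(\mu^*-\mu_{a^v(t)})\big]$ satisfies $$\mathbb{E}[R^G(n)]\le\sum_{i:\mu_i<\mu^*}\frac{8|D|\ln n}{\Delta_i}+d,\qquad d=\Big[2m-1+\frac{2m}{4\beta-1}\Big(1+\frac{1}{(4\beta-1)\ln(1/\beta)}\Big)\Big]\sum_{j=1}^K\Delta_j.$$ -/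

import Mathlib

open MeasureTheory ProbabilityTheory

/-! Collaborative stochastic multi-armed bandits on a network, and the Follow Your Leader policy.
The arms are `Fin K`. Rounds are counted from `0`: the index `t` stands for round `t + 1`, so that
`t` is also the number of rounds that are over when the action with index `t` is chosen. -/

namespace NetworkBandit

/-- The node `v` together with its one-hop neighbours. -/
def closedNbhd {V : Type*} (G : SimpleGraph V) (v : V) : Set V := {u | u = v ∨ G.Adj v u}

/-- `D` is a dominating set: every node outside `D` is adjacent to at least one node of `D`. -/
def IsDominatingSet {V : Type*} (G : SimpleGraph V) (D : Finset V) : Prop :=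
  ∀ v, v ∉ D → ∃ u ∈ D, G.Adj u v

/-- A dominating set partition based on `D`: a partition of the nodes into `|D|` components, each
of which contains a node of `D` and a subset of its one-hop neighbours. As there are as many
components as nodes of `D`, every component contains exactly one node of `D`, and the partition is
recorded by the map that sends a node to the node of `D` in its component. -/
structure DominatingSetPartition {V : Type*} (G : SimpleGraph V) (D : Finset V) where
  /-- The node of `D` in the component of a node. -/
  leader : V → V
  leader_mem : ∀ v, leader v ∈ D
  leader_of_mem : ∀ v ∈ D, leader v = v
  adj_leader : ∀ v, v ∉ D → G.Adj (leader v) v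

/-- The leader of a node is the node itself or one of its one-hop neighbours. -/
theorem DominatingSetPartition.leader_mem_closedNbhd {V : Type*} {G : SimpleGraph V} {D : Finset V}
    (P : DominatingSetPartition G D) (v : V) : P.leader v ∈ closedNbhd G v := by
  by_cases hv : v ∈ D
  · exact Or.inl (P.leader_of_mem v hv)
  · exact Or.inr (P.adj_leader v hv).symm

/-- What user `v` has observed after `t` rounds: the actions and the rewards of itself and of its
one-hop neighbours in these rounds. -/
abbrev History {V : Type*} (G : SimpleGraph V) (K : ℕ) (v : V) (t : ℕ) : Type _ :=
  Fin t → closedNbhd G v → Fin K × ℝ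

/-- A policy of the network: after `t` rounds, user `v` chooses its next action as a (measurable)
function of its observations, and possibly of a random arm that it has drawn privately. -/
structure NetworkPolicy {V : Type*} (G : SimpleGraph V) (K : ℕ) where
  choice : (v : V) → (t : ℕ) → Fin K → History G K v t → Fin K
  measurable_choice : ∀ v t,
    Measurable (fun p : Fin K × History G K v t => choice v t p.1 p.2)

/-- The actions that the policy `Φ` produces, given the privately drawn arms `z` and the table `x`
of rewards: `x t v i` is the reward that user `v` receives in the round with index `t` if it plays
arm `i` there. -/
noncomputable def NetworkPolicy.action {V : Type*} {G : SimpleGraph V} {K : ℕ}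
    (Φ : NetworkPolicy G K) (z : V → Fin K) (x : ℕ → V → Fin K → ℝ) (t : ℕ) (v : V) : Fin K :=
  Φ.choice v t (z v) (fun s u =>
    (Φ.action z x s.1 u.1, x s.1 u.1 (Φ.action z x s.1 u.1)))
termination_by t
decreasing_by all_goals exact s.2

section Leader

variable {V : Type*} [Fintype V] {G : SimpleGraph V} {D : Finset V} {K : ℕ}

open Classical in
/-- The number of times that arm `i` was chosen in the component of the leader `v`. -/
noncomputable def sampleCount (P : DominatingSetPartition G D) (v : V) {t : ℕ}
    (h : History G K v t) (i : Fin K) : ℕ :=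
  ∑ s : Fin t, ∑ u : closedNbhd G v, if P.leader u = v ∧ (h s u).1 = i then 1 else 0

open Classical in
/-- The average of the rewards obtained from arm `i` in the component of the leader `v`. -/
noncomputable def sampleMean (P : DominatingSetPartition G D) (v : V) {t : ℕ}
    (h : History G K v t) (i : Fin K) : ℝ :=
  1 / (sampleCount P v h i : ℝ) *
    ∑ s : Fin t, ∑ u : closedNbhd G v, if P.leader u = v ∧ (h s u).1 = i then (h s u).2 else 0

/-- The upper confidence index of arm `i` for the leader `v` after `t` rounds. -/
noncomputable def ucbIndex (P : DominatingSetPartition G D) (v : V) {t : ℕ}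
    (h : History G K v t) (i : Fin K) : ℝ :=
  sampleMean P v h i + Real.sqrt (2 * Real.log t / (sampleCount P v h i : ℝ))

/-- `Φ` is a Follow Your Leader policy for the given dominating set and partition. The leaders (the
nodes of `D`) play every arm once in the first `K` rounds, and then an arm of largest index (ties
are broken in any way). A follower plays a randomly drawn arm in the first round, and from then on
the action taken by its leader in the previous round. -/
structure IsFYL (P : DominatingSetPartition G D) (Φ : NetworkPolicy G K) : Prop where
  leader_init : ∀ v ∈ D, ∀ (t : ℕ) (ht : t < K) (z : Fin K) (h : History G K v t),
    Φ.choice v t z h = ⟨t, ht⟩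
  leader_loop : ∀ v ∈ D, ∀ t : ℕ, K ≤ t → ∀ (z : Fin K) (h : History G K v t) (j : Fin K),
    ucbIndex P v h j ≤ ucbIndex P v h (Φ.choice v t z h)
  follower_init : ∀ v, v ∉ D → ∀ (z : Fin K) (h : History G K v 0), Φ.choice v 0 z h = z
  follower_loop : ∀ v, v ∉ D → ∀ (t : ℕ) (z : Fin K) (h : History G K v (t + 1)),
    Φ.choice v (t + 1) z h = (h (Fin.last t) ⟨P.leader v, P.leader_mem_closedNbhd v⟩).1

end Leader

section Regret

variable {K : ℕ}

/-- The mean reward of arm `i`. -/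
noncomputable def armMean (ν : Fin K → Measure ℝ) (i : Fin K) : ℝ := ∫ y, y ∂(ν i)

/-- The largest mean reward. -/
noncomputable def optMean (ν : Fin K → Measure ℝ) : ℝ := ⨆ i, armMean ν i

/-- The gap `Δ i` of arm `i`. -/
noncomputable def gap (ν : Fin K → Measure ℝ) (i : Fin K) : ℝ := optMean ν - armMean ν i

/-- The (pseudo-)regret of the whole network up to round `n`, the sum over all users `v` and all
rounds `t ≤ n` of the largest mean minus the mean of the arm played by `v` in round `t`. -/
noncomputable def networkRegret {V : Type*} [Fintype V] {G : SimpleGraph V}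
    (ν : Fin K → Measure ℝ) (Φ : NetworkPolicy G K) (z : V → Fin K) (x : ℕ → V → Fin K → ℝ)
    (n : ℕ) : ℝ :=
  ∑ v : V, ∑ t ∈ Finset.range n, (optMean ν - armMean ν (Φ.action z x t v))

/-- The random environment: arm `i` has reward law `ν i`; the rewards `X t v i`, for all rounds
`t`, users `v` and arms `i`, are independent, `X t v i` having law `ν i`; and the arms `Z v` drawn
privately by the users (with an arbitrary joint law) are independent of all the rewards. -/
structure IsEnvironment {V Ω : Type*} [MeasurableSpace Ω] (Pr : Measure Ω)
    (ν : Fin K → Measure ℝ) (X : ℕ → V → Fin K → Ω → ℝ) (Z : V → Ω → Fin K) : Prop where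
  measurable_reward : ∀ t v i, Measurable (X t v i)
  reward_law : ∀ t v i, Measure.map (X t v i) Pr = ν i
  indep_rewards : iIndepFun (fun p : ℕ × V × Fin K => X p.1 p.2.1 p.2.2) Pr
  measurable_draw : ∀ v, Measurable (Z v)
  indep_draws : IndepFun (fun ω v => Z v ω) (fun ω (p : ℕ × V × Fin K) => X p.1 p.2.1 p.2.2 ω) Pr

end Regret

end NetworkBandit

open scoped ENNReal

namespace NetworkBandit

/-! ### Measurability of the actions -/

section Measurability

/-! The draws are independent of the rewards, so by Fubini it suffices to bound the regret for each
fixed vector `z` of draws. The actions of a round are then functions of the earlier rewards alone,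
and the regret is the sum over arms and components of the gap times the number of plays.

Fix a component with `c` users. Its followers copy the leader one round late, so its count of an arm
is (initial draws) + N(t+1) + (c - 1) N(t), where N counts the leader's picks
(`IsFYL.playCount_succ`). This has two consequences. The count cannot overshoot a threshold `y` by
more than 2c - 1, apart from `c` plays for each pick made above the threshold
(`IsFYL.playCount_le`). And at time `t` the count takes at most 2t values, however large the
component, so a union bound over these values costs only a factor 2t.

For each value of the count, an exponential supermartingale bounds the probability of leaving the
confidence interval by t⁻⁴ (`measure_deviates_inter_playCount_le`). A pick of a suboptimal arm above
the threshold 8 ln n / Δ² forces one of two such deviations (`IsFYL.deviates_or`), so the expected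
number of these picks is at most 2 ∑ 2t⁻³ ≤ 2. Each component thus plays the arm at most 8 ln n / Δ²
+ 4c - 1 times on average. Summation gives the additive constant 4m - 1, which is below the stated
one for every β (`one_le_regret_constant`). -/

theorem measurable_apply_index {α ι : Type*} [MeasurableSpace α] [Fintype ι] [MeasurableSpace ι]
    [MeasurableSingletonClass ι] {a : α → ι} {f : α → ι → ℝ} (ha : Measurable a)
    (hf : ∀ i, Measurable fun ω => f ω i) : Measurable fun ω => f ω (a ω) := by
  classical
  have h : (fun ω => f ω (a ω)) = fun ω => ∑ i, if a ω = i then f ω i else 0 := by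
    funext ω; simp
  rw [h]
  exact Finset.measurable_sum _ fun i _ =>
    Measurable.ite (ha (measurableSet_singleton i)) (hf i) measurable_const

/-- The action at time `t` is measurable with respect to the draws and the rewards before `t`. -/
theorem NetworkPolicy.measurable_action {V : Type*} {G : SimpleGraph V} {K : ℕ}
    (Φ : NetworkPolicy G K) {α : Type*} [MeasurableSpace α] {z : α → V → Fin K}
    {x : α → ℕ → V → Fin K → ℝ} (hz : ∀ v, Measurable fun ω => z ω v) (t : ℕ)
    (hx : ∀ s < t, ∀ v i, Measurable fun ω => x ω s v i) (u : V) :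
    Measurable fun ω => Φ.action (z ω) (x ω) t u := by
  induction t using Nat.strong_induction_on generalizing u with
  | _ t ih =>
    have h : (fun ω => Φ.action (z ω) (x ω) t u) = (fun p : Fin K × History G K u t =>
        Φ.choice u t p.1 p.2) ∘ fun ω => (z ω u, fun (s : Fin t) (w : closedNbhd G u) =>
          (Φ.action (z ω) (x ω) s w, x ω s w (Φ.action (z ω) (x ω) s w))) := by
      funext ω; simp only [Function.comp]; rw [NetworkPolicy.action]
    rw [h]
    refine (Φ.measurable_choice u t).comp ((hz u).prodMk ?_)
    refine measurable_pi_iff.2 fun s => measurable_pi_iff.2 fun w => ?_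
    have ha : Measurable fun ω => Φ.action (z ω) (x ω) s w :=
      ih s s.2 (fun r hr => hx r (hr.trans s.2)) w
    exact ha.prodMk (measurable_apply_index ha (hx s s.2 w))

end Measurability

/-! ### Exponential supermartingale for adaptively chosen plays -/

section Supermartingale

variable {V Ω : Type*} {K : ℕ} {mΩ : MeasurableSpace Ω}

/-- The information contained in the rewards whose round belongs to `S`. -/
@[reducible]
def rewardSigma (X : ℕ → V → Fin K → Ω → ℝ) (S : Set ℕ) : MeasurableSpace Ω :=
  ⨆ p ∈ {p : ℕ × V × Fin K | p.1 ∈ S},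
    MeasurableSpace.comap (X p.1 p.2.1 p.2.2) inferInstance

theorem measurable_rewardSigma (X : ℕ → V → Fin K → Ω → ℝ) {S : Set ℕ} {s : ℕ} (hs : s ∈ S)
    (v : V) (i : Fin K) : Measurable[rewardSigma X S] (X s v i) := by
  rw [measurable_iff_comap_le]
  exact le_iSup₂_of_le (f := fun (p : ℕ × V × Fin K) (_ : p ∈ {p : ℕ × V × Fin K | p.1 ∈ S}) =>
    MeasurableSpace.comap (X p.1 p.2.1 p.2.2) inferInstance) (s, v, i) hs le_rfl

theorem rewardSigma_le {X : ℕ → V → Fin K → Ω → ℝ} (hX : ∀ t v i, Measurable (X t v i))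
    (S : Set ℕ) : rewardSigma X S ≤ mΩ :=
  iSup₂_le fun p _ => (hX p.1 p.2.1 p.2.2).comap_le

theorem indep_rewardSigma {Pr : Measure Ω} {X : ℕ → V → Fin K → Ω → ℝ}
    (hX : ∀ t v i, Measurable (X t v i))
    (hind : iIndepFun (fun p : ℕ × V × Fin K => X p.1 p.2.1 p.2.2) Pr) {S T : Set ℕ}
    (hST : Disjoint S T) : Indep (rewardSigma X S) (rewardSigma X T) Pr := by
  refine indep_iSup_of_disjoint (m := fun p : ℕ × V × Fin K =>
    MeasurableSpace.comap (X p.1 p.2.1 p.2.2) inferInstance)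
    (fun p => (hX p.1 p.2.1 p.2.2).comap_le) ((iIndepFun_iff_iIndep _ _ _).1 hind) ?_
  rw [Set.disjoint_left] at hST ⊢
  exact fun p hp hq => hST hp hq

/-- The logarithm of the exponential supermartingale of the centred rewards of arm `i` in the
set `C` of users, when user `u` plays `A s u` in round `s`. -/
noncomputable def expWeight (X : ℕ → V → Fin K → Ω → ℝ) (A : ℕ → V → Ω → Fin K) (C : Finset V)
    (i : Fin K) (μ l : ℝ) (t : ℕ) (ω : Ω) : ℝ :=
  ∑ s ∈ Finset.range t, ∑ u ∈ C, if A s u ω = i then l * (X s u i ω - μ) - l ^ 2 / 8 else 0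

/-- Hoeffding's lemma: a variable in [0, 1] is sub-Gaussian with variance proxy (1/2)², whence the
compensator l²/8. -/
theorem lintegral_exp_centred_le {Pr : Measure Ω} [IsProbabilityMeasure Pr] {Y : Ω → ℝ}
    (hY : Measurable Y) (hb : ∀ᵐ ω ∂Pr, Y ω ∈ Set.Icc (0 : ℝ) 1) (l : ℝ) :
    ∫⁻ ω, ENNReal.ofReal (Real.exp (l * (Y ω - Pr[Y]) - l ^ 2 / 8)) ∂Pr ≤ 1 := by
  have h := hasSubgaussianMGF_of_mem_Icc hY.aemeasurable hb
  have hi := h.integrable_exp_mul l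
  have hm := h.mgf_le l
  have he : ∀ ω, Real.exp (l * (Y ω - Pr[Y]) - l ^ 2 / 8) =
      Real.exp (l * (Y ω - Pr[Y])) * Real.exp (-(l ^ 2 / 8)) := fun ω => by
    rw [← Real.exp_add, sub_eq_add_neg]
  simp_rw [he]
  rw [← ofReal_integral_eq_lintegral_ofReal (hi.mul_const _)
    (Filter.Eventually.of_forall fun ω => by positivity), integral_mul_const]
  rw [ENNReal.ofReal_le_one]
  have hc : ((((‖(1 : ℝ) - 0‖₊ / 2) ^ 2 : NNReal) : ℝ)) * l ^ 2 / 2 = l ^ 2 / 8 := by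
    simp; ring
  rw [hc] at hm
  calc _ ≤ Real.exp (l ^ 2 / 8) * Real.exp (-(l ^ 2 / 8)) := by
        gcongr; exact hm
    _ = 1 := by rw [← Real.exp_add]; simp

/-- Who plays arm `i` in a round is decided by the past, while the rewards of that round are
independent of the past and of each other. Each round therefore multiplies the expectation by at
most 1. -/
theorem lintegral_exp_expWeight_le [Fintype V] {Pr : Measure Ω} [IsProbabilityMeasure Pr]
    {X : ℕ → V → Fin K → Ω → ℝ} (hX : ∀ t v i, Measurable (X t v i))
    (hind : iIndepFun (fun p : ℕ × V × Fin K => X p.1 p.2.1 p.2.2) Pr)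
    (hb : ∀ t v i, ∀ᵐ ω ∂Pr, X t v i ω ∈ Set.Icc (0 : ℝ) 1)
    {A : ℕ → V → Ω → Fin K} (hA : ∀ t u, Measurable[rewardSigma X {s | s < t}] (A t u))
    (C : Finset V) (i : Fin K) {μ : ℝ} (hμ : ∀ t v, Pr[X t v i] = μ) (l : ℝ) (t : ℕ) :
    ∫⁻ ω, ENNReal.ofReal (Real.exp (expWeight X A C i μ l t ω)) ∂Pr ≤ 1 := by
  classical
  induction t with
  | zero => simp [expWeight]
  | succ t ih =>
    set Y : V → Ω → ℝ≥0∞ := fun u ω =>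
      ENNReal.ofReal (Real.exp (l * (X t u i ω - μ) - l ^ 2 / 8)) with hY
    set M : Ω → ℝ≥0∞ := fun ω => ENNReal.ofReal (Real.exp (expWeight X A C i μ l t ω)) with hM
    have hAle : ∀ s ≤ t, ∀ u, Measurable[rewardSigma X {s | s < t}] (A s u) := fun s hs u =>
      (hA s u).mono (iSup₂_le fun p hp => by
        refine (measurable_rewardSigma X (S := {s | s < t}) ?_ p.2.1 p.2.2).comap_le
        exact lt_of_lt_of_le hp hs) le_rfl
    have hMm : Measurable[rewardSigma X {s | s < t}] M := by
      refine Measurable.ennreal_ofReal (Real.measurable_exp.comp ?_)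
      refine Finset.measurable_sum _ fun s hs => Finset.measurable_sum _ fun u _ => ?_
      have hs := Finset.mem_range.1 hs
      refine Measurable.ite (hAle s hs.le u (measurableSet_singleton i)) ?_ measurable_const
      exact (((measurable_rewardSigma X (S := {s | s < t}) hs u i).sub_const _).const_mul
        _).sub_const _
    have hYm : ∀ u, Measurable[rewardSigma X {t}] (Y u) := fun u =>
      Measurable.ennreal_ofReal (Real.measurable_exp.comp
        ((((measurable_rewardSigma X (S := {t}) rfl u i).sub_const _).const_mul _).sub_const _))
    have hle := rewardSigma_le hX
    have hY1 : ∀ u, ∫⁻ ω, Y u ω ∂Pr ≤ 1 := fun u => by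
      have := lintegral_exp_centred_le (hX t u i) (hb t u i) l
      rwa [hμ t u] at this
    have hYi : iIndepFun Y Pr := by
      have h1 : iIndepFun (fun u => X t u i) Pr :=
        hind.precomp (g := fun u : V => (t, u, i)) fun a b h => by simpa using h
      exact h1.comp (fun _ y => ENNReal.ofReal (Real.exp (l * (y - μ) - l ^ 2 / 8)))
        fun _ => by fun_prop
    -- Splitting over the action profile `a` of round `t` makes the set of users playing `i`
    -- deterministic on each piece, so that each term is a past factor times a factor of the present
    -- rewards.
    have hdecomp : ∀ ω, ENNReal.ofReal (Real.exp (expWeight X A C i μ l (t + 1) ω)) =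
        ∑ a : V → Fin K, (M ω * if (∀ u, A t u ω = a u) then 1 else 0) *
          ∏ u ∈ C.filter (fun u => a u = i), Y u ω := by
      intro ω
      rw [Finset.sum_eq_single (fun u => A t u ω)]
      · rw [expWeight, Finset.sum_range_succ, Real.exp_add, ENNReal.ofReal_mul (Real.exp_nonneg _),
          Real.exp_sum C, ENNReal.ofReal_prod_of_nonneg fun _ _ => Real.exp_nonneg _,
          Finset.prod_filter]
        simp only [implies_true, if_true, mul_one]
        refine congrArg (M ω * ·) (Finset.prod_congr rfl fun u _ => ?_)
        split_ifs <;> simp [hY]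
      · intro a _ ha
        rw [if_neg]
        · simp
        · exact fun h => ha (funext fun u => (h u).symm)
      · simp
    have hIm : ∀ a : V → Fin K, Measurable[rewardSigma X {s | s < t}]
        fun ω => M ω * if (∀ u, A t u ω = a u) then (1 : ℝ≥0∞) else 0 := fun a => by
      refine Measurable.mul hMm (Measurable.ite ?_ measurable_const measurable_const)
      have : {ω | ∀ u, A t u ω = a u} = ⋂ u, A t u ⁻¹' {a u} := by ext; simp
      rw [this]
      exact MeasurableSet.iInter fun u => hAle t le_rfl u (measurableSet_singleton _)
    have hGm : ∀ a : V → Fin K, Measurable[rewardSigma X {t}]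
        fun ω => ∏ u ∈ C.filter (fun u => a u = i), Y u ω := fun a =>
      Finset.measurable_prod _ fun u _ => hYm u
    simp_rw [hdecomp]
    rw [lintegral_finsetSum (f := fun (a : V → Fin K) ω =>
      (M ω * if ∀ u, A t u ω = a u then 1 else 0) * ∏ u ∈ C with a u = i, Y u ω) _ fun a _ =>
      ((hIm a).mono (hle _) le_rfl).mul ((hGm a).mono (hle _) le_rfl)]
    calc _ ≤ ∑ a : V → Fin K, ∫⁻ ω, (M ω * if (∀ u, A t u ω = a u) then 1 else 0) ∂Pr := by
          refine Finset.sum_le_sum fun a _ => ?_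
          rw [lintegral_mul_eq_lintegral_mul_lintegral_of_independent_measurableSpace (hle _)
            (hle _) (indep_rewardSigma hX hind (by simp)) (hIm a) (hGm a)]
          refine mul_le_of_le_one_right' ?_
          have hp : ∀ S : Finset V, ∫⁻ ω, ∏ u ∈ S, Y u ω ∂Pr ≤ 1 := fun S => by
            rw [lintegral_prod_eq_prod_lintegral_of_indepFun S Y hYi
              fun u => (hYm u).mono (hle _) le_rfl]
            exact Finset.prod_le_one' fun u _ => hY1 u
          exact hp _
      _ = ∫⁻ ω, M ω ∂Pr := by
          rw [← lintegral_finsetSum _ fun a _ => (hIm a).mono (hle _) le_rfl]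
          refine lintegral_congr fun ω => ?_
          rw [← Finset.mul_sum, Finset.sum_eq_single (fun u => A t u ω)]
          · simp
          · intro a _ ha
            rw [if_neg]
            exact fun h => ha (funext fun u => (h u).symm)
          · simp
      _ ≤ 1 := ih

end Supermartingale

end NetworkBandit

namespace NetworkBandit

/-! ### Deviation probabilities at a fixed time -/

section Deviation

variable {V Ω : Type*} {K : ℕ} {mΩ : MeasurableSpace Ω}

/-- The number of times that the users in `C` play arm `i` before time `t`. -/
def playCount (A : ℕ → V → Fin K) (C : Finset V) (i : Fin K) (t : ℕ) : ℕ :=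
  ∑ s ∈ Finset.range t, ∑ u ∈ C, if A s u = i then 1 else 0

theorem playCount_le_mul (A : ℕ → V → Fin K) (C : Finset V) (i : Fin K) (t : ℕ) :
    playCount A C i t ≤ t * C.card := by
  calc playCount A C i t ≤ ∑ s ∈ Finset.range t, ∑ u ∈ C, 1 :=
        Finset.sum_le_sum fun s _ => Finset.sum_le_sum fun u _ => by split_ifs <;> simp
    _ = t * C.card := by simp

/-- The sum of the rewards, centred at `μ`, that the users in `C` obtain from arm `i` before
time `t`. -/
noncomputable def deviation (A : ℕ → V → Fin K) (x : ℕ → V → Fin K → ℝ) (C : Finset V)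
    (i : Fin K) (μ : ℝ) (t : ℕ) : ℝ :=
  ∑ s ∈ Finset.range t, ∑ u ∈ C, if A s u = i then x s u i - μ else 0

theorem expWeight_eq (X : ℕ → V → Fin K → Ω → ℝ) (A : ℕ → V → Ω → Fin K) (C : Finset V)
    (i : Fin K) (μ l : ℝ) (t : ℕ) (ω : Ω) :
    expWeight X A C i μ l t ω =
      l * deviation (fun s u => A s u ω) (fun s u j => X s u j ω) C i μ t -
        l ^ 2 / 8 * playCount (fun s u => A s u ω) C i t := by
  simp only [expWeight, deviation, playCount]
  push_cast
  rw [Finset.mul_sum, Finset.mul_sum, ← Finset.sum_sub_distrib]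
  refine Finset.sum_congr rfl fun s _ => ?_
  rw [Finset.mul_sum, Finset.mul_sum, ← Finset.sum_sub_distrib]
  refine Finset.sum_congr rfl fun u _ => ?_
  split_ifs <;> simp

theorem measurable_playCount {α : Type*} [MeasurableSpace α] {A : α → ℕ → V → Fin K}
    (hA : ∀ t u, Measurable fun ω => A ω t u) (C : Finset V) (i : Fin K) (t : ℕ) :
    Measurable fun ω => playCount (A ω) C i t :=
  Finset.measurable_sum _ fun s _ => Finset.measurable_sum _ fun u _ =>
    Measurable.ite (hA s u (measurableSet_singleton i)) measurable_const measurable_const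

theorem measurable_deviation {α : Type*} [MeasurableSpace α] {A : α → ℕ → V → Fin K}
    {x : α → ℕ → V → Fin K → ℝ} (hA : ∀ t u, Measurable fun ω => A ω t u)
    (hx : ∀ t u i, Measurable fun ω => x ω t u i) (C : Finset V) (i : Fin K) (μ : ℝ) (t : ℕ) :
    Measurable fun ω => deviation (A ω) (x ω) C i μ t :=
  Finset.measurable_sum _ fun s _ => Finset.measurable_sum _ fun u _ =>
    Measurable.ite (hA s u (measurableSet_singleton i)) ((hx s u i).sub_const _) measurable_const

/-- The event that the average reward of arm `i` differs from its mean by at least the confidence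
width, upwards (`σ = 1`) or downwards (`σ = -1`). -/
def Deviates (σ : ℝ) (A : ℕ → V → Fin K) (x : ℕ → V → Fin K → ℝ) (C : Finset V) (i : Fin K)
    (μ : ℝ) (t : ℕ) : Prop :=
  0 < playCount A C i t ∧
    Real.sqrt (2 * Real.log t * playCount A C i t) ≤ σ * deviation A x C i μ t

theorem measurableSet_deviates {α : Type*} [MeasurableSpace α] {A : α → ℕ → V → Fin K}
    {x : α → ℕ → V → Fin K → ℝ} (hA : ∀ t u, Measurable fun ω => A ω t u)
    (hx : ∀ t u i, Measurable fun ω => x ω t u i) (σ : ℝ) (C : Finset V) (i : Fin K) (μ : ℝ)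
    (t : ℕ) : MeasurableSet {ω | Deviates σ (A ω) (x ω) C i μ t} := by
  have h1 := measurable_playCount hA C i t
  have h2 := measurable_deviation hA hx C i μ t
  have h3 : Measurable fun ω => ((playCount (A ω) C i t : ℕ) : ℝ) :=
    measurable_from_top.comp h1
  exact (measurableSet_lt measurable_const h1).inter
    (measurableSet_le (h3.const_mul _).sqrt (h2.const_mul _))

variable [Fintype V] {Pr : Measure Ω} [IsProbabilityMeasure Pr] {X : ℕ → V → Fin K → Ω → ℝ}

/-- Fixing the count `m` allows the exponent to depend on it; Markov's inequality for the
supermartingale then gives the Chernoff bound. -/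
theorem measure_deviates_inter_playCount_le (hX : ∀ t v i, Measurable (X t v i))
    (hind : iIndepFun (fun p : ℕ × V × Fin K => X p.1 p.2.1 p.2.2) Pr)
    (hb : ∀ t v i, ∀ᵐ ω ∂Pr, X t v i ω ∈ Set.Icc (0 : ℝ) 1)
    {A : ℕ → V → Ω → Fin K} (hA : ∀ t u, Measurable[rewardSigma X {s | s < t}] (A t u))
    (C : Finset V) (i : Fin K) {μ : ℝ} (hμ : ∀ t v, Pr[X t v i] = μ) {σ : ℝ} (hσ : σ ^ 2 = 1)
    {t : ℕ} (ht : 1 ≤ t) (m : ℕ) :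
    Pr {ω | Deviates σ (fun s u => A s u ω) (fun s u j => X s u j ω) C i μ t ∧
      playCount (fun s u => A s u ω) C i t = m} ≤ ENNReal.ofReal ((t : ℝ) ^ 4)⁻¹ := by
  obtain rfl | hm := Nat.eq_zero_or_pos m
  · have : {ω | Deviates σ (fun s u => A s u ω) (fun s u j => X s u j ω) C i μ t ∧
      playCount (fun s u => A s u ω) C i t = 0} = ∅ := by
      ext ω
      simp only [Deviates, Set.mem_ofPred_eq, Set.mem_empty_iff_false, iff_false]
      omega
    rw [this, measure_empty]
    exact zero_le
  have hm' : (0 : ℝ) < m := by exact_mod_cast hm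
  have ht' : (1 : ℝ) ≤ t := by exact_mod_cast ht
  have hlog := Real.log_nonneg ht'
  set q := Real.sqrt (2 * Real.log t / m) with hq
  have hq2 : q ^ 2 * m = 2 * Real.log t := by
    rw [hq, Real.sq_sqrt (by positivity)]; field_simp
  have hqm : Real.sqrt (2 * Real.log t * m) = q * m := by
    rw [← hq2, show q ^ 2 * m * m = (q * m) ^ 2 by ring, Real.sqrt_sq (by positivity)]
  -- With deviation `q * m`, the exponent l q m - l² m / 8 is maximal at l = 4q, where it equals 2
  -- q² m = 4 log t.
  have hE := lintegral_exp_expWeight_le hX hind hb hA C i hμ (σ * (4 * q)) t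
  have hAm : ∀ t u, Measurable (A t u) := fun t u => (hA t u).mono (rewardSigma_le hX _) le_rfl
  have hmeas : Measurable fun ω =>
      ENNReal.ofReal (Real.exp (expWeight X A C i μ (σ * (4 * q)) t ω)) := by
    refine Measurable.ennreal_ofReal (Real.measurable_exp.comp ?_)
    refine Finset.measurable_sum _ fun s _ => Finset.measurable_sum _ fun u _ => ?_
    exact Measurable.ite (hAm s u (measurableSet_singleton i))
      ((((hX s u i).sub_const _).const_mul _).sub_const _) measurable_const
  have hpos : (0 : ℝ) < (t : ℝ) ^ 4 := by positivity
  have hM := (mul_meas_ge_le_lintegral (μ := Pr) hmeas (ENNReal.ofReal ((t : ℝ) ^ 4))).trans hE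
  rw [ENNReal.ofReal_inv_of_pos hpos]
  rw [mul_comm] at hM
  refine le_trans (measure_mono ?_) ((ENNReal.le_inv_iff_mul_le).2 hM)
  rintro ω ⟨⟨-, h2⟩, h3⟩
  refine ENNReal.ofReal_le_ofReal ?_
  rw [h3, hqm] at h2
  rw [expWeight_eq, h3, ← Real.log_le_iff_le_exp hpos, Real.log_pow]
  have h4 : (σ * (4 * q)) ^ 2 / 8 * m = 4 * Real.log t := by
    rw [mul_pow, hσ]; linear_combination 2 * hq2
  rw [h4]
  have h5 := mul_le_mul_of_nonneg_left h2 (by positivity : 0 ≤ 4 * q)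
  push_cast
  nlinarith

/-- Union bound over the possible counts; its price is the size of the deterministic set `S`, not
the number of samples. -/
theorem measureReal_deviates_le (hX : ∀ t v i, Measurable (X t v i))
    (hind : iIndepFun (fun p : ℕ × V × Fin K => X p.1 p.2.1 p.2.2) Pr)
    (hb : ∀ t v i, ∀ᵐ ω ∂Pr, X t v i ω ∈ Set.Icc (0 : ℝ) 1)
    {A : ℕ → V → Ω → Fin K} (hA : ∀ t u, Measurable[rewardSigma X {s | s < t}] (A t u))
    (C : Finset V) (i : Fin K) {μ : ℝ} (hμ : ∀ t v, Pr[X t v i] = μ) {σ : ℝ} (hσ : σ ^ 2 = 1)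
    {t : ℕ} (ht : 1 ≤ t) (S : Finset ℕ)
    (hS : ∀ ω, playCount (fun s u => A s u ω) C i t ∈ S) :
    Pr.real {ω | Deviates σ (fun s u => A s u ω) (fun s u j => X s u j ω) C i μ t} ≤
      S.card * ((t : ℝ) ^ 4)⁻¹ := by
  refine ENNReal.toReal_le_of_le_ofReal (by positivity) ?_
  calc _ ≤ Pr (⋃ m ∈ S, {ω | Deviates σ (fun s u => A s u ω) (fun s u j => X s u j ω) C i μ t ∧
        playCount (fun s u => A s u ω) C i t = m}) := by
        refine measure_mono fun ω hω => ?_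
        simp only [Set.mem_iUnion]
        exact ⟨_, hS ω, hω, rfl⟩
    _ ≤ ∑ m ∈ S, ENNReal.ofReal ((t : ℝ) ^ 4)⁻¹ :=
        (measure_biUnion_finset_le _ _).trans (Finset.sum_le_sum fun m _ =>
          measure_deviates_inter_playCount_le hX hind hb hA C i hμ hσ ht m)
    _ = _ := by
        rw [Finset.sum_const, ENNReal.ofReal_mul (by positivity), nsmul_eq_mul]
        simp

end Deviation

end NetworkBandit

namespace NetworkBandit

/-! ### Observations and pick counts of a single user -/

section History

variable {V : Type*} {G : SimpleGraph V} {K : ℕ}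

/-- The observations of user `v` before time `t`. -/
noncomputable def NetworkPolicy.history (Φ : NetworkPolicy G K) (z : V → Fin K)
    (x : ℕ → V → Fin K → ℝ) (t : ℕ) (v : V) : History G K v t :=
  fun s u => (Φ.action z x s u, x s u (Φ.action z x s u))

theorem NetworkPolicy.action_eq (Φ : NetworkPolicy G K) (z : V → Fin K)
    (x : ℕ → V → Fin K → ℝ) (t : ℕ) (v : V) :
    Φ.action z x t v = Φ.choice v t (z v) (Φ.history z x t v) := by
  rw [NetworkPolicy.action]; rfl

variable (Φ : NetworkPolicy G K) (z : V → Fin K) (x : ℕ → V → Fin K → ℝ)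

/-- The number of times that user `v` plays arm `i` before time `t`. -/
noncomputable def NetworkPolicy.pickCount (v : V) (i : Fin K) (t : ℕ) : ℕ :=
  ∑ s ∈ Finset.range t, if Φ.action z x s v = i then 1 else 0

theorem pickCount_le (v : V) (i : Fin K) (t : ℕ) : Φ.pickCount z x v i t ≤ t := by
  rw [NetworkPolicy.pickCount]
  calc _ ≤ ∑ s ∈ Finset.range t, 1 := Finset.sum_le_sum fun u _ => by split_ifs <;> simp
    _ = t := by simp

theorem pickCount_succ (v : V) (i : Fin K) (t : ℕ) :
    Φ.pickCount z x v i (t + 1) = Φ.pickCount z x v i t +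
      if Φ.action z x t v = i then 1 else 0 := by
  rw [NetworkPolicy.pickCount, Finset.sum_range_succ]; rfl

end History

/-! ### Components, delayed copying and the index argument -/

section Component

variable {V : Type*} [Fintype V] {G : SimpleGraph V} {D : Finset V} {K : ℕ}

open Classical in
/-- The component of the leader `v`. -/
noncomputable def DominatingSetPartition.component (P : DominatingSetPartition G D) (v : V) :
    Finset V :=
  Finset.univ.filter fun u => P.leader u = v

open Classical in
/-- The followers of the leader `v`. -/
noncomputable def DominatingSetPartition.followers (P : DominatingSetPartition G D) (v : V) :
    Finset V :=
  (P.component v).erase v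

theorem DominatingSetPartition.mem_component (P : DominatingSetPartition G D) {u v : V} :
    u ∈ P.component v ↔ P.leader u = v := by
  simp [DominatingSetPartition.component]

theorem DominatingSetPartition.mem_component_self (P : DominatingSetPartition G D) {v : V}
    (hv : v ∈ D) : v ∈ P.component v :=
  P.mem_component.2 (P.leader_of_mem v hv)

theorem DominatingSetPartition.sum_component {M : Type*} [AddCommMonoid M]
    (P : DominatingSetPartition G D) {v : V} (hv : v ∈ D) (f : V → M) :
    ∑ u ∈ P.component v, f u = f v + ∑ u ∈ P.followers v, f u := by
  classical
  rw [DominatingSetPartition.followers, Finset.add_sum_erase _ _ (P.mem_component_self hv)]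

theorem DominatingSetPartition.card_component (P : DominatingSetPartition G D) {v : V}
    (hv : v ∈ D) : (P.component v).card = (P.followers v).card + 1 := by
  classical
  rw [DominatingSetPartition.followers, Finset.card_erase_add_one (P.mem_component_self hv)]

theorem DominatingSetPartition.of_mem_followers (P : DominatingSetPartition G D) {u v : V}
    (hu : u ∈ P.followers v) : P.leader u = v ∧ u ∉ D := by
  classical
  rw [DominatingSetPartition.followers, Finset.mem_erase, P.mem_component] at hu
  exact ⟨hu.2, fun h => hu.1 ((P.leader_of_mem u h).symm.trans hu.2)⟩

theorem DominatingSetPartition.sum_univ {M : Type*} [AddCommMonoid M]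
    (P : DominatingSetPartition G D) (f : V → M) :
    ∑ u, f u = ∑ v ∈ D, ∑ u ∈ P.component v, f u := by
  classical
  rw [← Finset.sum_fiberwise_of_maps_to (g := P.leader) (t := D) fun u _ => P.leader_mem u]
  refine Finset.sum_congr rfl fun v _ => Finset.sum_congr ?_ fun _ _ => rfl
  ext u; simp [P.mem_component]

/-- A component lies in the closed neighbourhood of its leader, so the leader's statistics miss no
play of its component. -/
theorem DominatingSetPartition.sum_closedNbhd {M : Type*} [AddCommMonoid M]
    (P : DominatingSetPartition G D) {v : V} [Fintype (closedNbhd G v)]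
    [∀ u, Decidable (P.leader u = v)] (f : V → M) :
    (∑ u : closedNbhd G v, if P.leader u = v then f u else 0) = ∑ u ∈ P.component v, f u := by
  classical
  rw [← Finset.sum_filter]
  refine Finset.sum_bij (fun u _ => (u : V)) ?_ ?_ ?_ ?_
  · intro u hu; simpa [P.mem_component] using hu
  · intro a _ b _ h; exact Subtype.ext h
  · intro u hu
    rw [P.mem_component] at hu
    refine ⟨⟨u, ?_⟩, by simpa using hu, rfl⟩
    by_cases h : u ∈ D
    · exact Or.inl ((P.leader_of_mem u h).symm.trans hu)
    · exact Or.inr (hu ▸ P.adj_leader u h)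
  · intro _ _; rfl

variable (P : DominatingSetPartition G D) (Φ : NetworkPolicy G K) (z : V → Fin K)
  (x : ℕ → V → Fin K → ℝ)

theorem sampleCount_history (v : V) (t : ℕ) (i : Fin K) :
    sampleCount P v (Φ.history z x t v) i = playCount (Φ.action z x) (P.component v) i t := by
  classical
  rw [sampleCount, playCount, Finset.sum_range]
  refine Finset.sum_congr rfl fun s _ => ?_
  rw [← P.sum_closedNbhd]
  refine Finset.sum_congr rfl fun u _ => ?_
  rw [ite_and]; rfl

theorem sampleMean_history {v : V} {t : ℕ} {i : Fin K} (μ : ℝ)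
    (hpos : 0 < playCount (Φ.action z x) (P.component v) i t) :
    sampleMean P v (Φ.history z x t v) i = μ +
      deviation (Φ.action z x) x (P.component v) i μ t /
        playCount (Φ.action z x) (P.component v) i t := by
  classical
  have hpos' : (0 : ℝ) < playCount (Φ.action z x) (P.component v) i t := by exact_mod_cast hpos
  have h : (∑ s : Fin t, ∑ u : closedNbhd G v,
      if P.leader u = v ∧ (Φ.history z x t v s u).1 = i then (Φ.history z x t v s u).2 else 0) =
      deviation (Φ.action z x) x (P.component v) i μ t +
        μ * playCount (Φ.action z x) (P.component v) i t := by
    rw [deviation, playCount]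
    push_cast
    rw [Finset.mul_sum, ← Finset.sum_add_distrib, Finset.sum_range]
    refine Finset.sum_congr rfl fun s _ => ?_
    rw [Finset.mul_sum, ← Finset.sum_add_distrib, ← P.sum_closedNbhd]
    refine Finset.sum_congr rfl fun u _ => ?_
    rw [ite_and]
    refine if_congr Iff.rfl ?_ rfl
    by_cases h : (Φ.history z x t v s u).1 = i
    · have h' : Φ.action z x s u = i := h
      rw [if_pos h, if_pos h', if_pos h', ← h']
      simp [NetworkPolicy.history]
    · have h' : Φ.action z x s u ≠ i := h
      rw [if_neg h, if_neg h', if_neg h']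
      simp
  rw [sampleMean, sampleCount_history P Φ z x]
  refine Eq.trans (congrArg (_ * ·) h) ?_
  field_simp
  ring

/-- The number of followers of `v` whose drawn arm is `i`. -/
noncomputable def DominatingSetPartition.drawCount (v : V) (i : Fin K) : ℕ :=
  ∑ u ∈ P.followers v, if z u = i then 1 else 0

theorem drawCount_le (v : V) (i : Fin K) : P.drawCount z v i ≤ (P.followers v).card := by
  rw [DominatingSetPartition.drawCount, Finset.card_eq_sum_ones]
  exact Finset.sum_le_sum fun u _ => by split_ifs <;> simp

variable {P Φ}

theorem IsFYL.action_of_lt (hΦ : IsFYL P Φ) {v : V} (hv : v ∈ D) {t : ℕ} (ht : t < K) :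
    Φ.action z x t v = ⟨t, ht⟩ := by
  rw [Φ.action_eq]; exact hΦ.leader_init v hv t ht _ _

/-- The delay of one round is the shift between the two pick counts; the followers' first round
contributes only the draws. -/
theorem IsFYL.playCount_succ (hΦ : IsFYL P Φ) {v : V} (hv : v ∈ D) (i : Fin K) (t : ℕ) :
    playCount (Φ.action z x) (P.component v) i (t + 1) = P.drawCount z v i +
      Φ.pickCount z x v i (t + 1) + (P.followers v).card * Φ.pickCount z x v i t := by
  induction t with
  | zero =>
    simp only [playCount, NetworkPolicy.pickCount, zero_add, Finset.sum_range_one,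
      Finset.sum_range_zero, mul_zero, add_zero, DominatingSetPartition.drawCount]
    rw [P.sum_component hv, add_comm]
    congr 1
    refine Finset.sum_congr rfl fun u hu => ?_
    rw [Φ.action_eq, hΦ.follower_init u (P.of_mem_followers hu).2]
  | succ t ih =>
    have h1 : playCount (Φ.action z x) (P.component v) i (t + 1 + 1) =
        playCount (Φ.action z x) (P.component v) i (t + 1) +
          ((if Φ.action z x (t + 1) v = i then 1 else 0) +
            (P.followers v).card * (if Φ.action z x t v = i then 1 else 0)) := by
      rw [playCount, Finset.sum_range_succ, ← playCount, P.sum_component hv]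
      congr 2
      rw [← smul_eq_mul, ← Finset.sum_const]
      refine Finset.sum_congr rfl fun u hu => ?_
      obtain ⟨hu1, hu2⟩ := P.of_mem_followers hu
      have : Φ.action z x (t + 1) u = Φ.action z x t v := by
        rw [Φ.action_eq, hΦ.follower_loop u hu2]
        simp [NetworkPolicy.history, hu1]
      rw [this]
    rw [h1, ih, pickCount_succ Φ z x v i (t + 1), pickCount_succ Φ z x v i t]
    ring

/-- At a fixed time `t`, the sample count of an arm takes at most `2 * t` values. -/
theorem IsFYL.playCount_mem (hΦ : IsFYL P Φ) {v : V} (hv : v ∈ D) (i : Fin K) {t : ℕ}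
    (ht : 1 ≤ t) : playCount (Φ.action z x) (P.component v) i t ∈
      (Finset.range t ×ˢ Finset.range 2).image fun p : ℕ × ℕ =>
        P.drawCount z v i + (p.1 + p.2) + (P.followers v).card * p.1 := by
  obtain ⟨t, rfl⟩ : ∃ s, t = s + 1 := ⟨t - 1, by omega⟩
  rw [hΦ.playCount_succ z x hv, pickCount_succ, Finset.mem_image]
  -- Besides the fixed draws, the count depends only on the leader's earlier picks and on one bit
  -- for its latest action.
  refine ⟨(Φ.pickCount z x v i t, if Φ.action z x t v = i then 1 else 0), ?_, rfl⟩
  have := pickCount_le Φ z x v i t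
  rw [Finset.mem_product, Finset.mem_range, Finset.mem_range]
  refine ⟨by simp only; omega, by simp only; split_ifs <;> simp⟩

theorem IsFYL.playCount_pos (hΦ : IsFYL P Φ) {v : V} (hv : v ∈ D) (i : Fin K) {t : ℕ}
    (ht : K ≤ t) : 0 < playCount (Φ.action z x) (P.component v) i t := by
  rw [playCount]
  refine Finset.sum_pos' (fun _ _ => Nat.zero_le _)
    ⟨i, Finset.mem_range.2 (i.2.trans_le ht), ?_⟩
  refine Finset.sum_pos' (fun _ _ => Nat.zero_le _) ⟨v, P.mem_component_self hv, ?_⟩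
  rw [hΦ.action_of_lt z x hv i.2]
  simp

open Classical in
/-- The number of times before `t` that the leader `v` chooses arm `i` although its component has
already sampled the arm more than `y` times. -/
noncomputable def excessCount (P : DominatingSetPartition G D) (Φ : NetworkPolicy G K)
    (z : V → Fin K) (x : ℕ → V → Fin K → ℝ) (v : V) (i : Fin K) (y : ℝ) (t : ℕ) : ℕ :=
  ∑ s ∈ Finset.range t, if K ≤ s ∧ Φ.action z x s v = i ∧
    y < playCount (Φ.action z x) (P.component v) i s then 1 else 0

/-- A pick above the threshold raises both sides by the component size `c`. A repeated pick at or
below it happens when the count, which may lag behind the left side by c - 1, is at most `y`; the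
pick itself adds `c`, which gives 2c - 1. -/
theorem IsFYL.drawCount_add_le (hΦ : IsFYL P Φ) {v : V} (hv : v ∈ D) (i : Fin K) {y : ℝ}
    (hy : 0 ≤ y) (t : ℕ) :
    (P.drawCount z v i : ℝ) + (P.component v).card * Φ.pickCount z x v i t ≤
      y + (2 * (P.component v).card - 1) +
        (P.component v).card * excessCount P Φ z x v i y t := by
  classical
  rw [P.card_component hv]
  have hr : (P.drawCount z v i : ℝ) ≤ (P.followers v).card := by
    exact_mod_cast drawCount_le P z v i
  have hL : (0 : ℝ) ≤ (P.followers v).card := by positivity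
  have hB : ∀ t, (0 : ℝ) ≤ excessCount P Φ z x v i y t := fun t => by positivity
  push_cast
  induction t with
  | zero => simp [NetworkPolicy.pickCount, excessCount]; linarith
  | succ t ih =>
    have hsucc : excessCount P Φ z x v i y (t + 1) = excessCount P Φ z x v i y t +
        if K ≤ t ∧ Φ.action z x t v = i ∧
          y < playCount (Φ.action z x) (P.component v) i t then 1 else 0 := by
      rw [excessCount, Finset.sum_range_succ]
      unfold excessCount
      congr!
    have hmono : (excessCount P Φ z x v i y t : ℝ) ≤ excessCount P Φ z x v i y (t + 1) := by
      rw [hsucc]; exact_mod_cast Nat.le_add_right _ _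
    rw [pickCount_succ]
    by_cases hp : Φ.action z x t v = i
    swap
    · rw [if_neg hp]; push_cast; nlinarith
    rw [if_pos hp]
    push_cast
    obtain hN | hN := Nat.eq_zero_or_pos (Φ.pickCount z x v i t)
    · rw [hN]; push_cast; nlinarith [hB (t + 1), mul_nonneg hL (hB (t + 1))]
    have hKt : K ≤ t := by
      by_contra! htK
      have h0 : Φ.pickCount z x v i t = 0 := by
        rw [NetworkPolicy.pickCount]
        refine Finset.sum_eq_zero fun s hs => if_neg fun h => ?_
        have hs := Finset.mem_range.1 hs
        rw [← hp, hΦ.action_of_lt z x hv htK, hΦ.action_of_lt z x hv (hs.trans htK)] at h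
        simp only [Fin.mk.injEq] at h
        omega
      omega
    by_cases hm : y < playCount (Φ.action z x) (P.component v) i t
    · rw [hsucc, if_pos ⟨hKt, hp, hm⟩]; push_cast; nlinarith
    push Not at hm
    obtain ⟨t, rfl⟩ : ∃ s, t = s + 1 := ⟨t - 1, by
      have := pickCount_le Φ z x v i t
      omega⟩
    rw [hΦ.playCount_succ z x hv] at hm
    have h1 : Φ.pickCount z x v i (t + 1) ≤ Φ.pickCount z x v i t + 1 := by
      rw [pickCount_succ]; split_ifs <;> omega
    have h1 : (Φ.pickCount z x v i (t + 1) : ℝ) ≤ Φ.pickCount z x v i t + 1 := by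
      exact_mod_cast h1
    push_cast at hm
    nlinarith [hB (t + 1 + 1), mul_nonneg hL (hB (t + 1 + 1)), mul_le_mul_of_nonneg_left h1 hL]

theorem IsFYL.playCount_le (hΦ : IsFYL P Φ) {v : V} (hv : v ∈ D) (i : Fin K) {y : ℝ}
    (hy : 0 ≤ y) (t : ℕ) :
    (playCount (Φ.action z x) (P.component v) i t : ℝ) ≤
      y + (2 * (P.component v).card - 1) +
        (P.component v).card * excessCount P Φ z x v i y t := by
  refine le_trans ?_ (hΦ.drawCount_add_le z x hv i hy t)
  norm_cast
  cases t with
  | zero => simp [playCount]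
  | succ t =>
    rw [hΦ.playCount_succ z x hv, P.card_component hv, pickCount_succ]
    nlinarith [Nat.zero_le (if Φ.action z x t v = i then 1 else 0)]

theorem div_lt_sqrt_div {d y m : ℝ} (hm : 0 < m) (h : d < Real.sqrt (y * m)) :
    d / m < Real.sqrt (y / m) := by
  rw [div_lt_iff₀ hm]
  have : Real.sqrt (y / m) * m = Real.sqrt (y * m) := by
    rw [show y * m = y / m * m ^ 2 by field_simp, Real.sqrt_mul' _ (by positivity),
      Real.sqrt_sq hm.le]
  rwa [this]

/-- If the leader plays a sufficiently sampled arm `i` instead of `j`, then the average reward of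
one of these arms leaves its confidence interval. -/
theorem IsFYL.deviates_or (hΦ : IsFYL P Φ) {v : V} (hv : v ∈ D) {i j : Fin K} {μ : Fin K → ℝ}
    (hij : μ i < μ j) {t : ℕ} (ht : K ≤ t) (hi : Φ.action z x t v = i)
    (hm : 8 * Real.log t / (μ j - μ i) ^ 2 ≤ playCount (Φ.action z x) (P.component v) i t) :
    Deviates 1 (Φ.action z x) x (P.component v) i (μ i) t ∨
      Deviates (-1) (Φ.action z x) x (P.component v) j (μ j) t := by
  have hpi := hΦ.playCount_pos z x hv i ht
  have hpj := hΦ.playCount_pos z x hv j ht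
  by_contra! hcon
  simp only [Deviates, hpi, hpj, true_and, not_le] at hcon
  obtain ⟨h1, h2⟩ := hcon
  have h3 := hΦ.leader_loop v hv t ht (z v) (Φ.history z x t v) j
  rw [← Φ.action_eq, hi, ucbIndex, ucbIndex, sampleMean_history P Φ z x (μ i) hpi,
    sampleMean_history P Φ z x (μ j) hpj, sampleCount_history P Φ z x,
    sampleCount_history P Φ z x] at h3
  have hpi' : (0 : ℝ) < playCount (Φ.action z x) (P.component v) i t := by exact_mod_cast hpi
  have hpj' : (0 : ℝ) < playCount (Φ.action z x) (P.component v) j t := by exact_mod_cast hpj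
  have h4 := div_lt_sqrt_div hpi' h1
  have h5 := div_lt_sqrt_div hpj' h2
  have h6 : Real.sqrt (2 * Real.log t / playCount (Φ.action z x) (P.component v) i t) ≤
      (μ j - μ i) / 2 := by
    have hg : 0 < μ j - μ i := sub_pos.2 hij
    rw [Real.sqrt_le_left (by linarith)]
    rw [div_le_iff₀ (by positivity)] at hm ⊢
    nlinarith
  rw [neg_one_mul, neg_div] at h5
  rw [one_mul] at h4
  linarith

end Component

end NetworkBandit

namespace NetworkBandit

section Environment

variable {V Ω : Type*} {K : ℕ} [MeasurableSpace Ω] {Pr : Measure Ω} {ν : Fin K → Measure ℝ}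
  {X : ℕ → V → Fin K → Ω → ℝ} {Z : V → Ω → Fin K}

theorem IsEnvironment.ae_mem_Icc (h : IsEnvironment Pr ν X Z)
    (hν : ∀ i, ∀ᵐ y ∂(ν i), y ∈ Set.Icc (0 : ℝ) 1) (t : ℕ) (v : V) (i : Fin K) :
    ∀ᵐ ω ∂Pr, X t v i ω ∈ Set.Icc (0 : ℝ) 1 :=
  ae_of_ae_map (h.measurable_reward t v i).aemeasurable ((h.reward_law t v i).symm ▸ hν i)

theorem IsEnvironment.integral_eq (h : IsEnvironment Pr ν X Z) (t : ℕ) (v : V) (i : Fin K) :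
    Pr[X t v i] = armMean ν i := by
  rw [armMean, ← h.reward_law t v i]
  exact (integral_map (f := fun y => y) (h.measurable_reward t v i).aemeasurable
    aestronglyMeasurable_id).symm

theorem gap_nonneg (ν : Fin K → Measure ℝ) (i : Fin K) : 0 ≤ gap ν i :=
  sub_nonneg.2 (le_ciSup (Set.finite_range (armMean ν)).bddAbove i)

theorem exists_armMean_eq_optMean [NeZero K] (ν : Fin K → Measure ℝ) :
    ∃ j, armMean ν j = optMean ν :=
  exists_eq_ciSup_of_finite

end Environment

theorem sum_Ico_two_mul_inv_pow_four_le {n : ℕ} (hn : 2 ≤ n) :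
    ∑ t ∈ Finset.Ico 2 n, (2 * (t : ℝ)) * ((t : ℝ) ^ 4)⁻¹ ≤ 1 - 1 / ((n : ℝ) - 1) := by
  induction n, hn using Nat.le_induction with
  | base => norm_num
  | succ n hn ih =>
    rw [Finset.sum_Ico_succ_top hn]
    refine (add_le_add_left ih _).trans ?_
    have hn' : (2 : ℝ) ≤ n := by exact_mod_cast hn
    have h1 : (2 * (n : ℝ)) * ((n : ℝ) ^ 4)⁻¹ ≤ 1 / ((n : ℝ) - 1) - 1 / n := by
      rw [div_sub_div _ _ (by linarith) (by linarith), ← div_eq_mul_inv,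
        div_le_div_iff₀ (by positivity) (by nlinarith)]
      nlinarith [mul_nonneg (sq_nonneg ((n : ℝ) - 1)) (sq_nonneg (n : ℝ)), pow_pos (show (0:ℝ) < n by linarith) 2]
    push_cast
    rw [add_sub_cancel_right]
    linarith

theorem one_le_regret_constant {β : ℝ} (hβ : β ∈ Set.Ioo (1 / 4 : ℝ) 1) :
    1 ≤ 1 / (4 * β - 1) * (1 + 1 / ((4 * β - 1) * Real.log (1 / β))) := by
  obtain ⟨h1, h2⟩ := hβ
  have hβ0 : 0 < β := by linarith
  have hx : 0 < 4 * β - 1 := by linarith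
  have hL : 0 < Real.log (1 / β) := Real.log_pos (by rw [lt_div_iff₀ hβ0]; linarith)
  have hL2 : Real.log (1 / β) ≤ (1 - β) / β :=
    (Real.log_le_sub_one_of_pos (by positivity)).trans (le_of_eq (by field_simp))
  have h3 : β / ((4 * β - 1) * (1 - β)) ≤ 1 / ((4 * β - 1) * Real.log (1 / β)) := by
    rw [le_div_iff₀ hβ0] at hL2
    rw [div_le_div_iff₀ (by nlinarith) (by positivity)]
    nlinarith
  have h4 : 4 * β - 2 ≤ β / ((4 * β - 1) * (1 - β)) := by
    rw [le_div_iff₀ (by nlinarith)]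
    nlinarith [mul_nonneg hx.le (sq_nonneg (4 * β - 3))]
  rw [one_div_mul_eq_div, le_div_iff₀ hx]
  linarith

section ExpectedCount

variable {V Ω : Type*} [Fintype V] {G : SimpleGraph V} {D : Finset V} {K : ℕ}
  [MeasurableSpace Ω] {Pr : Measure Ω} [IsProbabilityMeasure Pr] {ν : Fin K → Measure ℝ}
  {X : ℕ → V → Fin K → Ω → ℝ} {Z : V → Ω → Fin K} {P : DominatingSetPartition G D}
  {Φ : NetworkPolicy G K}

theorem measureReal_action_deviates_le (hXZ : IsEnvironment Pr ν X Z)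
    (hν : ∀ i, ∀ᵐ y ∂(ν i), y ∈ Set.Icc (0 : ℝ) 1) (hΦ : IsFYL P Φ) (z : V → Fin K) {v : V}
    (hv : v ∈ D) (i : Fin K) {σ : ℝ} (hσ : σ ^ 2 = 1) {t : ℕ} (ht : 1 ≤ t) :
    Pr.real {ω | Deviates σ (Φ.action z fun t v i => X t v i ω) (fun t v i => X t v i ω)
      (P.component v) i (armMean ν i) t} ≤ (2 * (t : ℝ)) * ((t : ℝ) ^ 4)⁻¹ := by
  have hA : ∀ t u, Measurable[rewardSigma X {s | s < t}]
      fun ω => Φ.action z (fun t v i => X t v i ω) t u := fun t u =>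
    @NetworkPolicy.measurable_action V G K Φ Ω (rewardSigma X {s | s < t}) (fun _ => z)
      (fun ω t v i => X t v i ω) (fun _ => measurable_const) t
      (fun s hs v i => measurable_rewardSigma X (S := {s | s < t}) hs v i) u
  refine (measureReal_deviates_le hXZ.measurable_reward hXZ.indep_rewards
    (hXZ.ae_mem_Icc hν) hA (P.component v) i (fun t v => hXZ.integral_eq t v i) hσ ht _
    fun ω => hΦ.playCount_mem z (fun t v i => X t v i ω) hv i ht).trans ?_
  gcongr
  refine (Nat.cast_le.2 Finset.card_image_le).trans (le_of_eq ?_)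
  simp [mul_comm]

theorem integral_playCount_le (hXZ : IsEnvironment Pr ν X Z)
    (hν : ∀ i, ∀ᵐ y ∂(ν i), y ∈ Set.Icc (0 : ℝ) 1) (hΦ : IsFYL P Φ) (z : V → Fin K) {v : V}
    (hv : v ∈ D) {i j : Fin K} (hij : armMean ν i < armMean ν j) (n : ℕ) :
    ∫ ω, (playCount (Φ.action z fun t v i => X t v i ω) (P.component v) i n : ℝ) ∂Pr ≤
      8 * Real.log n / (armMean ν j - armMean ν i) ^ 2 + (4 * (P.component v).card - 1) := by
  classical
  set y := 8 * Real.log n / (armMean ν j - armMean ν i) ^ 2 with hy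
  have hy0 : 0 ≤ y := by
    have := Real.log_natCast_nonneg n
    positivity
  have hg : 0 < armMean ν j - armMean ν i := sub_pos.2 hij
  have hK : 2 ≤ K := by
    by_contra! hK
    have : i = j := Fin.ext (by omega)
    exact absurd hij (by rw [this]; exact lt_irrefl _)
  set c : ℝ := ((P.component v).card : ℝ) with hc
  set T := (Finset.range n).filter fun t => K ≤ t with hT
  set U : Fin K → ℝ → ℕ → Set Ω := fun k σ t =>
    {ω | Deviates σ (Φ.action z fun t v i => X t v i ω) (fun t v i => X t v i ω)
      (P.component v) k (armMean ν k) t} with hU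
  have hAm : ∀ t u, Measurable fun ω => Φ.action z (fun t v i => X t v i ω) t u := fun t u =>
    Φ.measurable_action (z := fun _ => z) (fun _ => measurable_const) t
      (fun s _ => hXZ.measurable_reward s) u
  have hUm : ∀ k σ t, MeasurableSet (U k σ t) := fun k σ t =>
    measurableSet_deviates hAm hXZ.measurable_reward σ _ k _ t
  have hpath : ∀ ω, (playCount (Φ.action z fun t v i => X t v i ω) (P.component v) i n : ℝ) ≤
      y + (2 * c - 1) + c * ∑ t ∈ T, ((U i 1 t).indicator (fun _ => (1 : ℝ)) ω +
        (U j (-1) t).indicator (fun _ => (1 : ℝ)) ω) := by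
    intro ω
    refine (hΦ.playCount_le z (fun t v i => X t v i ω) hv i hy0 n).trans ?_
    gcongr
    rw [excessCount, hT, Finset.sum_filter]
    push_cast
    refine Finset.sum_le_sum fun t ht => ?_
    have hi1 : ∀ S : Set Ω, 0 ≤ S.indicator (fun _ => (1 : ℝ)) ω := fun S =>
      Set.indicator_nonneg (fun _ _ => zero_le_one) ω
    split_ifs with h1 h2 h2
    · obtain ⟨hKt, ha, hm⟩ := h1
      have hlog : Real.log t ≤ Real.log n :=
        Real.log_le_log (by exact_mod_cast (by omega : 0 < t))
          (by exact_mod_cast (Finset.mem_range.1 ht).le)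
      have hm' : 8 * Real.log t / (armMean ν j - armMean ν i) ^ 2 ≤
          playCount (Φ.action z fun t v i => X t v i ω) (P.component v) i t := by
        refine le_trans ?_ hm.le
        rw [hy]; gcongr
      rcases hΦ.deviates_or z (fun t v i => X t v i ω) hv (μ := armMean ν) hij hKt ha hm'
        with h | h
      · rw [Set.indicator_of_mem (show ω ∈ U i 1 t from h)]
        linarith [hi1 (U j (-1) t)]
      · rw [Set.indicator_of_mem (show ω ∈ U j (-1) t from h)]
        linarith [hi1 (U i 1 t)]
    · exact absurd h1.1 h2
    · linarith [hi1 (U i 1 t), hi1 (U j (-1) t)]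
    · exact le_rfl
  have hint : ∀ k σ t, Integrable ((U k σ t).indicator fun _ => (1 : ℝ)) Pr := fun k σ t =>
    (integrable_const _).indicator (hUm k σ t)
  have hintT : Integrable (fun ω => ∑ t ∈ T, ((U i 1 t).indicator (fun _ => (1 : ℝ)) ω +
        (U j (-1) t).indicator (fun _ => (1 : ℝ)) ω)) Pr :=
    integrable_finsetSum _ fun t _ => (hint i 1 t).add (hint j (-1) t)
  have hsum : ∫ ω, ∑ t ∈ T, ((U i 1 t).indicator (fun _ => (1 : ℝ)) ω +
        (U j (-1) t).indicator (fun _ => (1 : ℝ)) ω) ∂Pr ≤ 2 := by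
    rw [integral_finsetSum (f := fun t ω => (U i 1 t).indicator (fun _ => (1 : ℝ)) ω +
        (U j (-1) t).indicator (fun _ => (1 : ℝ)) ω) _ fun t _ => (hint i 1 t).add (hint j (-1) t)]
    have hone : ∀ k σ, σ ^ 2 = 1 → ∀ t ∈ T,
        ∫ ω, (U k σ t).indicator (fun _ => (1 : ℝ)) ω ∂Pr ≤
          (2 * (t : ℝ)) * ((t : ℝ) ^ 4)⁻¹ := fun k σ hσ t ht => by
      rw [integral_indicator_const _ (hUm k σ t), smul_eq_mul, mul_one]
      refine measureReal_action_deviates_le hXZ hν hΦ z hv k hσ ?_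
      have := (Finset.mem_filter.1 ht).2
      omega
    have hS : ∑ t ∈ T, (2 * (t : ℝ)) * ((t : ℝ) ^ 4)⁻¹ ≤ 1 := by
      have hsub : T ⊆ Finset.Ico 2 (n + 2) := fun t ht => by
        rw [hT, Finset.mem_filter, Finset.mem_range] at ht
        rw [Finset.mem_Ico]; omega
      refine (Finset.sum_le_sum_of_subset_of_nonneg hsub fun _ _ _ => by positivity).trans
        ((sum_Ico_two_mul_inv_pow_four_le (by omega)).trans ?_)
      have : (0 : ℝ) ≤ 1 / (((n + 2 : ℕ) : ℝ) - 1) := by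
        push_cast
        exact div_nonneg zero_le_one (by linarith [n.cast_nonneg (α := ℝ)])
      linarith
    calc _ ≤ ∑ t ∈ T, ((2 * (t : ℝ)) * ((t : ℝ) ^ 4)⁻¹ + (2 * (t : ℝ)) * ((t : ℝ) ^ 4)⁻¹) := by
          refine Finset.sum_le_sum fun t ht => ?_
          rw [integral_add (hint i 1 t) (hint j (-1) t)]
          exact add_le_add (hone i 1 (by norm_num) t ht) (hone j (-1) (by norm_num) t ht)
      _ ≤ 2 := by rw [Finset.sum_add_distrib]; linarith
  calc _ ≤ ∫ ω, (y + (2 * c - 1) + c * ∑ t ∈ T, ((U i 1 t).indicator (fun _ => (1 : ℝ)) ω +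
        (U j (-1) t).indicator (fun _ => (1 : ℝ)) ω)) ∂Pr :=
        integral_mono_of_nonneg (Filter.Eventually.of_forall fun ω => by positivity)
          ((integrable_const _).add (hintT.const_mul _)) (Filter.Eventually.of_forall hpath)
    _ = y + (2 * c - 1) + c * ∫ ω, ∑ t ∈ T, ((U i 1 t).indicator (fun _ => (1 : ℝ)) ω +
        (U j (-1) t).indicator (fun _ => (1 : ℝ)) ω) ∂Pr := by
        rw [integral_add (integrable_const _) (hintT.const_mul _), integral_const_mul]
        simp
    _ ≤ _ := by
        have : (0 : ℝ) ≤ c := by positivity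
        nlinarith

end ExpectedCount

section Regret

variable {V Ω : Type*} [Fintype V] {G : SimpleGraph V} {D : Finset V} {K : ℕ}

theorem networkRegret_eq (P : DominatingSetPartition G D) (ν : Fin K → Measure ℝ)
    (Φ : NetworkPolicy G K) (z : V → Fin K) (x : ℕ → V → Fin K → ℝ) (n : ℕ) :
    networkRegret ν Φ z x n =
      ∑ i, gap ν i * ∑ v ∈ D, (playCount (Φ.action z x) (P.component v) i n : ℝ) := by
  have h : ∀ u t, optMean ν - armMean ν (Φ.action z x t u) =
      ∑ i, gap ν i * if Φ.action z x t u = i then 1 else 0 := fun u t => by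
    simp [gap]
  rw [networkRegret, P.sum_univ]
  simp_rw [h]
  simp only [playCount, Nat.cast_sum, Nat.cast_ite, Nat.cast_one, Nat.cast_zero, Finset.mul_sum]
  rw [Finset.sum_comm]
  conv_rhs => rw [Finset.sum_comm]
  rw [Finset.sum_comm]
  refine Finset.sum_congr rfl fun v _ => ?_
  rw [Finset.sum_comm]
  conv_rhs => rw [Finset.sum_comm]
  refine Finset.sum_congr rfl fun t _ => ?_
  rw [Finset.sum_comm]

end Regret

end NetworkBandit

namespace NetworkBandit

section ExpectedRegret

variable {V Ω : Type*} [Fintype V] {G : SimpleGraph V} {D : Finset V} {K : ℕ}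

theorem measurable_networkRegret (ν : Fin K → Measure ℝ) (Φ : NetworkPolicy G K) {α : Type*}
    [MeasurableSpace α] {z : α → V → Fin K} {x : α → ℕ → V → Fin K → ℝ}
    (hz : ∀ v, Measurable fun ω => z ω v) (hx : ∀ t v i, Measurable fun ω => x ω t v i) (n : ℕ) :
    Measurable fun ω => networkRegret ν Φ (z ω) (x ω) n :=
  Finset.measurable_sum _ fun v _ => Finset.measurable_sum _ fun t _ =>
    (measurable_from_top (f := fun i : Fin K => optMean ν - armMean ν i)).comp
      (Φ.measurable_action hz t (fun s _ => hx s) v)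

theorem networkRegret_nonneg (ν : Fin K → Measure ℝ) (Φ : NetworkPolicy G K) (z : V → Fin K)
    (x : ℕ → V → Fin K → ℝ) (n : ℕ) : 0 ≤ networkRegret ν Φ z x n :=
  Finset.sum_nonneg fun _ _ => Finset.sum_nonneg fun _ _ => gap_nonneg ν _

theorem networkRegret_le (ν : Fin K → Measure ℝ) (Φ : NetworkPolicy G K) (z : V → Fin K)
    (x : ℕ → V → Fin K → ℝ) (n : ℕ) :
    networkRegret ν Φ z x n ≤ ∑ _v : V, ∑ _t ∈ Finset.range n, ∑ i, gap ν i :=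
  Finset.sum_le_sum fun _ _ => Finset.sum_le_sum fun _ _ =>
    Finset.single_le_sum (f := gap ν) (fun i _ => gap_nonneg ν i) (Finset.mem_univ _)

variable [MeasurableSpace Ω] {Pr : Measure Ω} [IsProbabilityMeasure Pr] {ν : Fin K → Measure ℝ}
  {X : ℕ → V → Fin K → Ω → ℝ} {Z : V → Ω → Fin K} {P : DominatingSetPartition G D}
  {Φ : NetworkPolicy G K}

theorem integrable_networkRegret {α : Type*} [MeasurableSpace α] {ρ : Measure α}
    [IsFiniteMeasure ρ] {z : α → V → Fin K} {x : α → ℕ → V → Fin K → ℝ}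
    (hz : ∀ v, Measurable fun ω => z ω v) (hx : ∀ t v i, Measurable fun ω => x ω t v i) (n : ℕ) :
    Integrable (fun ω => networkRegret ν Φ (z ω) (x ω) n) ρ := by
  refine Integrable.of_bound (measurable_networkRegret ν Φ hz hx n).aestronglyMeasurable
    (∑ _v : V, ∑ _t ∈ Finset.range n, ∑ i, gap ν i) (Filter.Eventually.of_forall fun ω => ?_)
  rw [Real.norm_of_nonneg (networkRegret_nonneg ..)]
  exact networkRegret_le ..

/-- The bound on the expected regret when the draws are fixed. -/
theorem integral_networkRegret_le [Nonempty V] [NeZero K] (hXZ : IsEnvironment Pr ν X Z)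
    (hν : ∀ i, ∀ᵐ y ∂(ν i), y ∈ Set.Icc (0 : ℝ) 1) (hΦ : IsFYL P Φ) (z : V → Fin K) (n : ℕ) :
    ∫ ω, networkRegret ν Φ z (fun t v i => X t v i ω) n ∂Pr ≤
      (∑ i with armMean ν i < optMean ν, 8 * (D.card : ℝ) * Real.log n / gap ν i) +
        (4 * (Fintype.card V : ℝ) - 1) * ∑ j, gap ν j := by
  classical
  obtain ⟨j, hj⟩ := exists_armMean_eq_optMean ν
  have hAm : ∀ t u, Measurable fun ω => Φ.action z (fun t v i => X t v i ω) t u := fun t u =>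
    Φ.measurable_action (z := fun _ => z) (fun _ => measurable_const) t
      (fun s _ => hXZ.measurable_reward s) u
  have hint : ∀ v i, Integrable (fun ω =>
      (playCount (Φ.action z fun t v i => X t v i ω) (P.component v) i n : ℝ)) Pr := fun v i => by
    refine Integrable.of_bound ((measurable_from_top (f := fun k : ℕ => (k : ℝ))).comp
      (measurable_playCount hAm _ i n)).aestronglyMeasurable
      ((n * (P.component v).card : ℕ) : ℝ) (Filter.Eventually.of_forall fun ω => ?_)
    rw [Real.norm_of_nonneg (Nat.cast_nonneg _)]
    exact Nat.cast_le.2 (playCount_le_mul _ _ _ _)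
  have hD : (1 : ℝ) ≤ D.card := by
    obtain ⟨v⟩ := ‹Nonempty V›
    exact_mod_cast Finset.card_pos.2 ⟨_, P.leader_mem v⟩
  have hcard : ∑ v ∈ D, ((P.component v).card : ℝ) = Fintype.card V := by
    have := P.sum_univ fun _ => (1 : ℝ)
    simp only [Finset.sum_const, nsmul_eq_mul, mul_one, Finset.card_univ] at this
    exact this.symm
  simp_rw [networkRegret_eq P]
  rw [integral_finsetSum _ fun i _ => (integrable_finsetSum _ fun v _ => hint v i).const_mul _,
    Finset.mul_sum, Finset.sum_filter, ← Finset.sum_add_distrib]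
  refine Finset.sum_le_sum fun i _ => ?_
  rw [integral_const_mul, integral_finsetSum _ fun v _ => hint v i]
  split_ifs with hi
  · have hg : 0 < gap ν i := sub_pos.2 hi
    have hsum : ∑ v ∈ D, ∫ ω,
        (playCount (Φ.action z fun t v i => X t v i ω) (P.component v) i n : ℝ) ∂Pr ≤
        ∑ v ∈ D, (8 * Real.log n / gap ν i ^ 2 + (4 * ((P.component v).card : ℝ) - 1)) := by
      refine Finset.sum_le_sum fun v hv => ?_
      have := integral_playCount_le hXZ hν hΦ z hv (hj.symm ▸ hi) n
      rwa [hj] at this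
    rw [Finset.sum_add_distrib, Finset.sum_sub_distrib, ← Finset.mul_sum, hcard] at hsum
    simp only [Finset.sum_const, nsmul_eq_mul, mul_one] at hsum
    calc _ ≤ gap ν i * (D.card * (8 * Real.log n / gap ν i ^ 2) +
          (4 * (Fintype.card V : ℝ) - D.card)) := mul_le_mul_of_nonneg_left hsum hg.le
      _ = 8 * (D.card : ℝ) * Real.log n / gap ν i +
          (4 * (Fintype.card V : ℝ) - D.card) * gap ν i := by field_simp
      _ ≤ _ := by gcongr
  · have hg : gap ν i = 0 := le_antisymm (sub_nonpos.2 (not_lt.1 hi)) (gap_nonneg ν i)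
    simp [hg]

/-- The expectation over draws and rewards is bounded as soon as it is bounded for fixed draws. -/
theorem integral_networkRegret_le_of_forall (hXZ : IsEnvironment Pr ν X Z) (n : ℕ) {B : ℝ}
    (hB : ∀ z, ∫ ω, networkRegret ν Φ z (fun t v i => X t v i ω) n ∂Pr ≤ B) :
    ∫ ω, networkRegret ν Φ (fun v => Z v ω) (fun t v i => X t v i ω) n ∂Pr ≤ B := by
  have hZm : Measurable fun ω v => Z v ω := measurable_pi_iff.2 hXZ.measurable_draw
  have hXm : Measurable fun ω (p : ℕ × V × Fin K) => X p.1 p.2.1 p.2.2 ω :=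
    measurable_pi_iff.2 fun p => hXZ.measurable_reward p.1 p.2.1 p.2.2
  set F : (V → Fin K) × (ℕ × V × Fin K → ℝ) → ℝ := fun q =>
    networkRegret ν Φ q.1 (fun t v i => q.2 (t, v, i)) n with hF
  have hz : ∀ v, Measurable fun q : (V → Fin K) × (ℕ × V × Fin K → ℝ) => q.1 v :=
    fun v => (measurable_pi_apply v).comp measurable_fst
  have hx : ∀ t v i, Measurable fun q : (V → Fin K) × (ℕ × V × Fin K → ℝ) => q.2 (t, v, i) :=
    fun t v i => (measurable_pi_apply (t, v, i)).comp measurable_snd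
  have hFm : Measurable F := measurable_networkRegret ν Φ hz hx n
  have := Measure.isProbabilityMeasure_map (μ := Pr) hZm.aemeasurable
  have := Measure.isProbabilityMeasure_map (μ := Pr) hXm.aemeasurable
  have hprod := (indepFun_iff_map_prod_eq_prod_map_map hZm.aemeasurable hXm.aemeasurable).1
    hXZ.indep_draws
  have hFi : Integrable F ((Pr.map fun ω v => Z v ω).prod
      (Pr.map fun ω (p : ℕ × V × Fin K) => X p.1 p.2.1 p.2.2 ω)) :=
    integrable_networkRegret hz hx n
  calc _ = ∫ q, F q ∂(Pr.map fun ω =>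
        ((fun v => Z v ω), fun p : ℕ × V × Fin K => X p.1 p.2.1 p.2.2 ω)) :=
        (integral_map (hZm.prodMk hXm).aemeasurable hFm.aestronglyMeasurable).symm
    _ = ∫ z, ∫ x, F (z, x) ∂(Pr.map fun ω (p : ℕ × V × Fin K) => X p.1 p.2.1 p.2.2 ω)
        ∂(Pr.map fun ω v => Z v ω) := by
        rw [hprod, integral_prod _ hFi]
    _ ≤ ∫ _z, B ∂(Pr.map fun ω v => Z v ω) := by
        refine integral_mono hFi.integral_prod_left (integrable_const _) fun z => ?_
        refine le_trans (le_of_eq ?_) (hB z)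
        exact integral_map hXm.aemeasurable
          (hFm.comp measurable_prodMk_left).aestronglyMeasurable
    _ = B := by simp

end ExpectedRegret

end NetworkBandit

theorem theorem6 {V : Type*} [Fintype V] [Nonempty V] (G : SimpleGraph V)
    (D : Finset V) (_hD : NetworkBandit.IsDominatingSet G D)
    (P : NetworkBandit.DominatingSetPartition G D)
    {K : ℕ} [NeZero K] (ν : Fin K → Measure ℝ) [∀ i, IsProbabilityMeasure (ν i)]
    (hν : ∀ i, ∀ᵐ y ∂(ν i), y ∈ Set.Icc (0 : ℝ) 1)
    {Ω : Type*} [MeasurableSpace Ω] (Pr : Measure Ω) [IsProbabilityMeasure Pr]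
    (X : ℕ → V → Fin K → Ω → ℝ) (Z : V → Ω → Fin K)
    (hXZ : NetworkBandit.IsEnvironment Pr ν X Z)
    (Φ : NetworkBandit.NetworkPolicy G K) (hΦ : NetworkBandit.IsFYL P Φ)
    (n : ℕ) (β : ℝ) (hβ : β ∈ Set.Ioo (1 / 4 : ℝ) 1) :
    Integrable (fun ω => NetworkBandit.networkRegret ν Φ (fun v => Z v ω)
      (fun t v i => X t v i ω) n) Pr ∧
    ∫ ω, NetworkBandit.networkRegret ν Φ (fun v => Z v ω) (fun t v i => X t v i ω) n ∂Pr ≤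
      (∑ i with NetworkBandit.armMean ν i < NetworkBandit.optMean ν,
        8 * (D.card : ℝ) * Real.log n / NetworkBandit.gap ν i) +
      (2 * (Fintype.card V : ℝ) - 1 + 2 * (Fintype.card V : ℝ) / (4 * β - 1) *
        (1 + 1 / ((4 * β - 1) * Real.log (1 / β)))) * ∑ j, NetworkBandit.gap ν j := by
  refine ⟨NetworkBandit.integrable_networkRegret hXZ.measurable_draw hXZ.measurable_reward n,
    (NetworkBandit.integral_networkRegret_le_of_forall hXZ n
      (NetworkBandit.integral_networkRegret_le hXZ hν hΦ · n)).trans ?_⟩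
  have h1 := NetworkBandit.one_le_regret_constant hβ
  have h2 : 0 ≤ ∑ j, NetworkBandit.gap ν j :=
    Finset.sum_nonneg fun j _ => NetworkBandit.gap_nonneg ν j
  gcongr
  have h3 : (0 : ℝ) ≤ 2 * Fintype.card V := by positivity
  rw [div_eq_mul_one_div, mul_assoc (2 * (Fintype.card V : ℝ))]
  nlinarith [mul_le_mul_of_nonneg_left h1 h3]
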